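/- A \emph{complete $C_\omega$-structure} $\langle A,N\rangle$ is a complete Boolean algebra $A$ with a family $(N_x)_{x\in A}$ of subsets of $A$ such that (i) for every $x\in A$ there is $x'\in N_x$ with $x\vee x'=1$, and (ii) for all $x\in A$, $x'\in N_x$ there is $x''\in N_{x'}$ with $x''\le x$. Let $\mathbf V^{\langle A,N\rangle}$ be the usual universe of $A$-valued names ($A$-valued functions whose domain is a set of names, defined by transfinite recursion). Consider the sentences of the language of set theory ($\in,\approx,\wedge,\vee,\to,\neg,\forall,\exists$) with constants for all names, and let $\|\cdot\|$ be any map from these sentences to $A$ such that, for all names $u,v$, sentences $\varphi,\psi$ and formulas $\phi(x)$ with at most the free variable $x$: $$\|u\in v\|=\bigvee_{x\in \mathrm{dom}(v)}\big(v(x)\wedge\|x\approx u\|\big),\qquad \|u\approx v\|=\bigwedge_{x\in \mathrm{dom}(u)}\big(u(x)\to\|x\in v\|\big)\wedge\bigwedge_{x\in \mathrm{dom}(v)}\big(v(x)\to\|x\in u\|\big),$$ $$\|\varphi\#\psi\|=\|\varphi\|\#\|\psi\|\ (\#\in\{\wedge,\vee,\to\}),\qquad \|\neg\varphi\|\in N_{\|\varphi\|},\qquad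 \|\neg\neg\varphi\|\le\|\varphi\|,$$ $$\|\exists x\,\phi\|=\bigvee_u\|\phi(u)\|,\qquad \|\forall x\,\phi\|=\bigwedge_u\|\phi(u)\|,\qquad \|u\approx v\|\le\|\neg\phi(u)\|\to\|\neg\phi(v)\|.$$ A sentence $\varphi$ is \emph{valid} in $\mathbf V^{\langle A,N\rangle}$ if $\|\varphi\|=1$. \textbf{Lemma.} For every complete $C_\omega$-structure $\langle A,N\rangle$ and every such map $\|\cdot\|$: (1) Zorn's Lemma is valid in $\mathbf V^{\langle A,N\rangle}$, that is, the sentence ``for all $X$ and $\le$: if $X$ has an element, $\le$ partially orders $X$, and every chain in $X$ has an upper bound in $X$, then $X$ has a maximal element'' is valid. Here $\le$ is a set of ordered pairs, and $m\in X$ is maximal if $\forall t\in X\,(m\le t\to t\approx m)$. (2) The axiom of choice is valid in $\mathbf V^{\langle A,N\rangle}$, in the form $$\forall u\,\exists f\,\big[\mathrm{Fun}(f)\wedge \mathrm{dom}(f)\approx u\wedge\forall x\in u\,\big(\exists z\,(z\in x)\to f(x)\in x\big)\big].$$ (3) Let $\emptyset$ be the name with empty domain. The variant of the sentence in (2) in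 which $\exists z\,(z\in x)$ is replaced by $\neg(x\approx\emptyset)$, with the paraconsistent negation $\neg$, is valid if and only if $\|\neg(\emptyset\approx\emptyset)\|=0$. -/

import Mathlib

universe u

namespace CwSet

/-- A `C_ω`-structure (Fidel structure for `C_ω`) over the Boolean algebra `A`: a family
`N x` of subsets of `A` with the two closure conditions. -/
structure CwStructure (A : Type u) [BooleanAlgebra A] where
  N : A → Set A
  exists_sup_eq_top : ∀ x, ∃ x' ∈ N x, x ⊔ x' = ⊤
  exists_le : ∀ x, ∀ x' ∈ N x, ∃ x'' ∈ N x', x'' ≤ x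

/-- The universe of names `V^A`, with `Type u` as the ambient universe of sets. A name is an
`A`-valued function on a set of earlier names; here the function is presented by a small indexed
family of pairs `(dom i, val i)`. Every family is equal with truth value `⊤` to the function that
sends a name to the supremum of its values. -/
inductive Name (A : Type u) : Type (u + 1)
  | mk (ι : Type u) (dom : ι → Name A) (val : ι → A) : Name A

namespace Name

variable {A : Type u}

/-- The index type of the domain of a name. -/
def Idx : Name A → Type u
  | mk ι _ _ => ι

/-- The elements of the domain of a name. -/
def dom : (v : Name A) → v.Idx → Name A
  | mk _ d _ => d

/-- The values of a name. -/
def val : (v : Name A) → v.Idx → A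
  | mk _ _ a => a

/-- The name with empty domain. -/
def empty : Name A := mk PEmpty PEmpty.elim PEmpty.elim

end Name

/-- Terms in context `n`: one of the variables `0, …, n - 1`, or a constant from `C`. -/
inductive Tm (C : Type u) (n : ℕ) : Type u
  | var (i : Fin n) : Tm C n
  | const (c : C) : Tm C n

/-- Formulas of the language of set theory with connectives `∧, ∨, →, ¬` and with constants from
`C`, whose free variables are among `0, …, n - 1`. A quantifier applied to a formula in context
`n + 1` binds the last variable, `n`. -/
inductive Fml (C : Type u) : ℕ → Type u
  | mem {n : ℕ} (s t : Tm C n) : Fml C n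
  | eq {n : ℕ} (s t : Tm C n) : Fml C n
  | and {n : ℕ} (φ ψ : Fml C n) : Fml C n
  | or {n : ℕ} (φ ψ : Fml C n) : Fml C n
  | imp {n : ℕ} (φ ψ : Fml C n) : Fml C n
  | neg {n : ℕ} (φ : Fml C n) : Fml C n
  | all {n : ℕ} (φ : Fml C (n + 1)) : Fml C n
  | ex {n : ℕ} (φ : Fml C (n + 1)) : Fml C n

/-- Sentences are the formulas without free variables. -/
abbrev Sentence (C : Type u) : Type u := Fml C 0

/-- Replace the variable `0` by the constant `c` (and rename each variable `i + 1` to `i`). -/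
def Tm.inst {C : Type u} {n : ℕ} (c : C) : Tm C (n + 1) → Tm C n
  | .var i => Fin.cases (.const c) Tm.var i
  | .const d => .const d

/-- The result `φ(c)` of replacing the free variable `0` by the constant `c`. As bound variables
are numbered after the free ones, nothing can be captured. -/
def Fml.inst {C : Type u} (c : C) : {n : ℕ} → Fml C (n + 1) → Fml C n
  | _, .mem s t => .mem (s.inst c) (t.inst c)
  | _, .eq s t => .eq (s.inst c) (t.inst c)
  | _, .and φ ψ => .and (φ.inst c) (ψ.inst c)
  | _, .or φ ψ => .or (φ.inst c) (ψ.inst c)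
  | _, .imp φ ψ => .imp (φ.inst c) (ψ.inst c)
  | _, .neg φ => .neg (φ.inst c)
  | _, .all φ => .all (φ.inst c)
  | _, .ex φ => .ex (φ.inst c)

/-- The atomic sentence `u ∈ v` about two constants. -/
abbrev memS {C : Type u} (u v : C) : Sentence C := .mem (.const u) (.const v)

/-- The atomic sentence `u ≈ v` about two constants. -/
abbrev eqS {C : Type u} (u v : C) : Sentence C := .eq (.const u) (.const v)

/-- The truth-value maps of the `C_ω`-structure-valued model `V^⟨A,N⟩`: all maps `⟦·⟧` from
sentences with names as constants to `A` subject to the defining clauses. The clauses determine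
the value of every sentence without negation; the value of `¬ φ` may be any element of `N ⟦φ⟧`
compatible with the last clauses. -/
structure TruthValue {A : Type u} [CompleteBooleanAlgebra A] (S : CwStructure A) where
  tv : Sentence (Name A) → A
  tv_mem : ∀ u v : Name A, tv (memS u v) = ⨆ i : v.Idx, v.val i ⊓ tv (eqS (v.dom i) u)
  tv_eq : ∀ u v : Name A, tv (eqS u v) =
    (⨅ i : u.Idx, u.val i ⇨ tv (memS (u.dom i) v)) ⊓
      ⨅ j : v.Idx, v.val j ⇨ tv (memS (v.dom j) u)
  tv_and : ∀ φ ψ, tv (.and φ ψ) = tv φ ⊓ tv ψ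
  tv_or : ∀ φ ψ, tv (.or φ ψ) = tv φ ⊔ tv ψ
  tv_imp : ∀ φ ψ, tv (.imp φ ψ) = tv φ ⇨ tv ψ
  tv_neg_mem : ∀ φ, tv (.neg φ) ∈ S.N (tv φ)
  tv_neg_neg_le : ∀ φ, tv (.neg (.neg φ)) ≤ tv φ
  tv_ex : ∀ φ : Fml (Name A) 1, tv (.ex φ) = ⨆ u : Name A, tv (φ.inst u)
  tv_all : ∀ φ : Fml (Name A) 1, tv (.all φ) = ⨅ u : Name A, tv (φ.inst u)
  tv_leibniz : ∀ (u v : Name A) (φ : Fml (Name A) 1),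
    tv (eqS u v) ≤ tv (.neg (φ.inst u)) ⇨ tv (.neg (φ.inst v))

/-- A sentence is valid in the model if its truth value is the top element. -/
def TruthValue.Valid {A : Type u} [CompleteBooleanAlgebra A] {S : CwStructure A}
    (V : TruthValue S) (φ : Sentence (Name A)) : Prop :=
  V.tv φ = ⊤

section Sentences

variable {C : Type u} {n : ℕ}

/-- A term, read in a context with one more variable. -/
def Tm.lift : Tm C n → Tm C (n + 1)
  | .var i => .var i.castSucc
  | .const c => .const c

/-- The variable bound by a quantifier in context `n`. -/
def Tm.new : Tm C (n + 1) := .var (Fin.last n)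

namespace Fml

/-- `φ ↔ ψ` -/
def iff (φ ψ : Fml C n) : Fml C n := (φ.imp ψ).and (ψ.imp φ)

/-- `∀ y ∈ t, φ(y)` -/
def allIn (t : Tm C n) (φ : Fml C (n + 1)) : Fml C n := .all ((Fml.mem .new t.lift).imp φ)

/-- `∃ y ∈ t, φ(y)` -/
def exIn (t : Tm C n) (φ : Fml C (n + 1)) : Fml C n := .ex ((Fml.mem .new t.lift).and φ)

/-- `z = {a, b}` -/
def isUPair (z a b : Tm C n) : Fml C n :=
  .all (iff (.mem .new z.lift) ((Fml.eq .new a.lift).or (.eq .new b.lift)))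

/-- `p = ⟨a, b⟩ = {{a}, {a, b}}` -/
def isPair (p a b : Tm C n) : Fml C n :=
  .all (iff (.mem .new p.lift)
    ((isUPair .new a.lift a.lift).or (isUPair .new a.lift b.lift)))

/-- `⟨a, b⟩ ∈ r` -/
def pairMem (a b r : Tm C n) : Fml C n := exIn r (isPair .new a.lift b.lift)

/-- `x` has an element. -/
def nonempty (x : Tm C n) : Fml C n := .ex (.mem .new x.lift)

/-- `x ⊆ y` -/
def subset (x y : Tm C n) : Fml C n := allIn x (.mem .new y.lift)

/-- `∀ a ∈ x, a ≤ a`, where `a ≤ b` is `⟨a, b⟩ ∈ r`. -/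
def isRefl (x r : Tm C n) : Fml C n := allIn x (pairMem .new .new r.lift)

/-- `∀ a b ∈ x, a ≤ b ∧ b ≤ a → a ≈ b` -/
def isAntisymm (x r : Tm C n) : Fml C n :=
  allIn x <| allIn x.lift <|
    ((pairMem Tm.new.lift .new r.lift.lift).and (pairMem .new Tm.new.lift r.lift.lift)).imp
      (.eq Tm.new.lift .new)

/-- `∀ a b c ∈ x, a ≤ b ∧ b ≤ c → a ≤ c` -/
def isTrans (x r : Tm C n) : Fml C n :=
  allIn x <| allIn x.lift <| allIn x.lift.lift <|
    ((pairMem Tm.new.lift.lift Tm.new.lift r.lift.lift.lift).and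
      (pairMem Tm.new.lift .new r.lift.lift.lift)).imp
      (pairMem Tm.new.lift.lift .new r.lift.lift.lift)

/-- `r` partially orders `x`. -/
def isPartialOrder (x r : Tm C n) : Fml C n :=
  (isRefl x r).and ((isAntisymm x r).and (isTrans x r))

/-- `c` is a chain in `x`: `c ⊆ x` and `∀ a b ∈ c, a ≤ b ∨ b ≤ a`. -/
def isChain (c x r : Tm C n) : Fml C n :=
  (subset c x).and <| allIn c <| allIn c.lift <|
    (pairMem Tm.new.lift .new r.lift.lift).or (pairMem .new Tm.new.lift r.lift.lift)

/-- `c` has an upper bound in `x`: `∃ b ∈ x, ∀ a ∈ c, a ≤ b`. -/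
def hasUpperBound (c x r : Tm C n) : Fml C n :=
  exIn x <| allIn c.lift <| pairMem .new Tm.new.lift r.lift.lift

/-- Every chain in `x` has an upper bound in `x`. -/
def isInductive (x r : Tm C n) : Fml C n :=
  .all ((isChain .new x.lift r.lift).imp (hasUpperBound .new x.lift r.lift))

/-- `x` has a maximal element: `∃ m ∈ x, ∀ t ∈ x, m ≤ t → t ≈ m`. -/
def hasMaximal (x r : Tm C n) : Fml C n :=
  exIn x <| allIn x.lift <| (pairMem Tm.new.lift .new r.lift.lift).imp (.eq .new Tm.new.lift)

/-- Zorn's Lemma: every non-empty inductive partially ordered set `⟨x, r⟩` (variables `0`, `1`)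
has a maximal element. -/
def zornLemma : Sentence C :=
  .all <| .all <|
    ((nonempty (.var 0)).and ((isPartialOrder (.var 0) (.var 1)).and
      (isInductive (.var 0) (.var 1)))).imp (hasMaximal (.var 0) (.var 1))

/-- `Fun(f)`: `f` is a set of ordered pairs, and it is single-valued. -/
def isFun (f : Tm C n) : Fml C n :=
  (allIn f <| .ex <| .ex <| isPair Tm.new.lift.lift Tm.new.lift .new).and
    (.all <| .all <| .all <|
      ((pairMem Tm.new.lift.lift Tm.new.lift f.lift.lift.lift).and
        (pairMem Tm.new.lift.lift .new f.lift.lift.lift)).imp (.eq Tm.new.lift .new))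

/-- `dom(f) ≈ x`: there is `d ≈ x` whose elements are the first coordinates of `f`. -/
def domEq (f x : Tm C n) : Fml C n :=
  .ex <| (Fml.all <| iff (.mem .new Tm.new.lift)
    (.ex (pairMem Tm.new.lift .new f.lift.lift.lift))).and (.eq .new x.lift)

/-- `f(x) ∈ x`: there is `y` with `⟨x, y⟩ ∈ f` and `y ∈ x`. -/
def valueMem (f x : Tm C n) : Fml C n :=
  .ex ((pairMem x.lift .new f.lift).and (.mem .new x.lift))

/-- The sentence `∀ u ∃ f [Fun(f) ∧ dom(f) ≈ u ∧ ∀ x ∈ u (ν(x) → f(x) ∈ x)]`, for a formula `ν`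
expressing that `x` is not empty. The variables `u, f, x` are `0, 1, 2`. -/
def choiceFor (ν : Fml C 3) : Sentence C :=
  .all <| .ex <| (isFun (.var 1)).and <| (domEq (.var 1) (.var 0)).and <|
    allIn (.var 0) <| ν.imp (valueMem (.var 1) (.var 2))

/-- The axiom of choice, where "`x` is not empty" is `∃ z (z ∈ x)`. -/
def axiomOfChoice : Sentence C := choiceFor (nonempty (.var 2))

/-- The axiom of choice, where "`x` is not empty" is `¬ (x ≈ o)`, with the negation of the
object language and a constant `o`. -/
def axiomOfChoiceNeg (o : C) : Sentence C := choiceFor (.neg (.eq (.var 2) (.const o)))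

end Fml

end Sentences

end CwSet

/-! Sentences without negation are evaluated as in the Boolean-valued model `V^A`. The laws of
equality therefore hold, and mixing along antichains gives the maximum principle `exists_eq_iSup`.
Zorn's Lemma (`le_hasMaximal`): let `b` be the value of the hypotheses. Apply Zorn outside the model
to the names that lie in `X` with value at least `b`, compared by `b ≤ ‖y ≤ z‖`. A chain of names
generates a subset of `X` in the model, and the maximum principle names an upper bound. A maximal
`m` is maximal in the model: a `t` above `m` only on a part of `b` is mixed with `m` into a name
above `m` on all of `b`. Choice (`exists_choice`): well-order the index type of `u` and keep the
pair of the `i`-th element and its chosen member with the value of "no earlier index gives the same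
element". Negation enters only in the third claim. If `‖¬(∅ ≈ ∅)‖ = 0`, the Leibniz clause puts
`‖¬(x ≈ ∅)‖` below `‖∃ z, z ∈ x‖`, which reduces the claim to the second. Conversely, test `u =
{∅}`: no value `f(∅)` can be a member of `∅`. -/

open scoped symmDiff

namespace CwSet

/-! ### Evaluation of formulas under assignments -/

section Evaluation

variable {C : Type u} {n : ℕ}

/-- The value of a term under an assignment of constants to the variables. -/
def Tm.ev (e : Fin n → C) : Tm C n → C
  | .var i => e i
  | .const c => c

@[simp] lemma Tm.ev_var (e : Fin n → C) (i : Fin n) : (Tm.var i).ev e = e i := rfl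

@[simp] lemma Tm.ev_const (e : Fin n → C) (c : C) : (Tm.const c : Tm C n).ev e = c := rfl

@[simp] lemma Tm.ev_lift (t : Tm C n) (e : Fin n → C) (u : C) :
    t.lift.ev (Fin.snoc e u : Fin (n + 1) → C) = t.ev e := by
  cases t <;> simp [Tm.lift]

@[simp] lemma Tm.ev_new (e : Fin n → C) (u : C) :
    Tm.new.ev (Fin.snoc e u : Fin (n + 1) → C) = u := by
  simp [Tm.new]

lemma Tm.ev_inst (t : Tm C (n + 1)) (e : Fin (n + 1) → C) :
    (t.inst (e 0)).ev (Fin.tail e) = t.ev e := by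
  cases t with
  | var i => cases i using Fin.cases <;> rfl
  | const c => rfl

lemma Tm.eq_const_ev (t : Tm C 0) (e : Fin 0 → C) : t = .const (t.ev e) := by
  cases t with
  | var i => exact i.elim0
  | const c => rfl

/-- The sentence obtained from a formula by replacing the variables by constants. -/
def Fml.close : {n : ℕ} → Fml C n → (Fin n → C) → Sentence C
  | 0, φ, _ => φ
  | _ + 1, φ, e => (φ.inst (e 0)).close (Fin.tail e)

lemma Fml.close_mem (s t : Tm C n) (e : Fin n → C) :
    (Fml.mem s t).close e = memS (s.ev e) (t.ev e) := by
  induction n with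
  | zero => rw [memS, ← s.eq_const_ev e, ← t.eq_const_ev e]; rfl
  | succ n ih => rw [← s.ev_inst e, ← t.ev_inst e, Fml.close, Fml.inst]; exact ih (s.inst (e 0)) (t.inst (e 0)) (Fin.tail e)

lemma Fml.close_eq (s t : Tm C n) (e : Fin n → C) :
    (Fml.eq s t).close e = eqS (s.ev e) (t.ev e) := by
  induction n with
  | zero => rw [eqS, ← s.eq_const_ev e, ← t.eq_const_ev e]; rfl
  | succ n ih => rw [← s.ev_inst e, ← t.ev_inst e, Fml.close, Fml.inst]; exact ih (s.inst (e 0)) (t.inst (e 0)) (Fin.tail e)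

lemma Fml.close_and (φ ψ : Fml C n) (e : Fin n → C) :
    (φ.and ψ).close e = (φ.close e).and (ψ.close e) := by
  induction n with
  | zero => rfl
  | succ n ih => simp only [Fml.close, Fml.inst]; exact ih (φ.inst (e 0)) (ψ.inst (e 0)) (Fin.tail e)

lemma Fml.close_or (φ ψ : Fml C n) (e : Fin n → C) :
    (φ.or ψ).close e = (φ.close e).or (ψ.close e) := by
  induction n with
  | zero => rfl
  | succ n ih => simp only [Fml.close, Fml.inst]; exact ih (φ.inst (e 0)) (ψ.inst (e 0)) (Fin.tail e)

lemma Fml.close_imp (φ ψ : Fml C n) (e : Fin n → C) :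
    (φ.imp ψ).close e = (φ.close e).imp (ψ.close e) := by
  induction n with
  | zero => rfl
  | succ n ih => simp only [Fml.close, Fml.inst]; exact ih (φ.inst (e 0)) (ψ.inst (e 0)) (Fin.tail e)

lemma Fml.close_neg (φ : Fml C n) (e : Fin n → C) :
    φ.neg.close e = (φ.close e).neg := by
  induction n with
  | zero => rfl
  | succ n ih => simp only [Fml.close, Fml.inst]; exact ih (φ.inst (e 0)) (Fin.tail e)

/-- Closing substitutes for the first variable, while quantifiers bind the last one. That the two
commute drives the inductions for `ev_all` and `ev_ex`. -/
lemma Fml.close_snoc (φ : Fml C (n + 2)) (e : Fin (n + 1) → C) (u : C) :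
    φ.close (Fin.snoc e u : Fin (n + 2) → C) =
      (φ.inst (e 0)).close (Fin.snoc (Fin.tail e) u : Fin (n + 1) → C) := by
  have h0 : (Fin.snoc e u : Fin (n + 2) → C) 0 = e 0 := by
    exact Fin.snoc_castSucc (α := fun _ => C) u e 0
  have ht : Fin.tail (Fin.snoc e u : Fin (n + 2) → C) = Fin.snoc (Fin.tail e) u := by
    funext i
    cases i using Fin.lastCases with
    | last => simp only [Fin.tail, Fin.snoc_last, Fin.succ_last]
    | cast i => simp only [Fin.tail, Fin.snoc_castSucc, Fin.succ_castSucc]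
  rw [Fml.close, h0, ht]

end Evaluation

/-! ### Boolean-valued equality and membership -/

namespace TruthValue

variable {A : Type u} [CompleteBooleanAlgebra A] {S : CwStructure A} (V : TruthValue S) {n : ℕ}

/-- The truth value of a formula under an assignment of names to the variables. -/
def ev (φ : Fml (Name A) n) (e : Fin n → Name A) : A := V.tv (φ.close e)

/-- The truth value of `u ≈ v`. -/
def E (u v : Name A) : A := V.tv (eqS u v)

/-- The truth value of `u ∈ v`. -/
def M (u v : Name A) : A := V.tv (memS u v)

variable (e : Fin n → Name A)

lemma ev_sentence (φ : Sentence (Name A)) (e : Fin 0 → Name A) : V.ev φ e = V.tv φ := rfl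

@[simp] lemma ev_mem (s t : Tm (Name A) n) : V.ev (.mem s t) e = V.M (s.ev e) (t.ev e) := by
  rw [ev, Fml.close_mem, M]

@[simp] lemma ev_eq (s t : Tm (Name A) n) : V.ev (.eq s t) e = V.E (s.ev e) (t.ev e) := by
  rw [ev, Fml.close_eq, E]

@[simp] lemma ev_and (φ ψ : Fml (Name A) n) : V.ev (φ.and ψ) e = V.ev φ e ⊓ V.ev ψ e := by
  rw [ev, Fml.close_and, V.tv_and, ev, ev]

@[simp] lemma ev_or (φ ψ : Fml (Name A) n) : V.ev (φ.or ψ) e = V.ev φ e ⊔ V.ev ψ e := by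
  rw [ev, Fml.close_or, V.tv_or, ev, ev]

@[simp] lemma ev_imp (φ ψ : Fml (Name A) n) : V.ev (φ.imp ψ) e = V.ev φ e ⇨ V.ev ψ e := by
  rw [ev, Fml.close_imp, V.tv_imp, ev, ev]

lemma ev_neg_eq (s t : Tm (Name A) n) :
    V.ev (.neg (.eq s t)) e = V.tv (.neg (eqS (s.ev e) (t.ev e))) := by
  rw [ev, Fml.close_neg, Fml.close_eq]

@[simp] lemma ev_all (φ : Fml (Name A) (n + 1)) :
    V.ev φ.all e = ⨅ u, V.ev φ (Fin.snoc e u : Fin (n + 1) → Name A) := by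
  induction n with
  | zero =>
    refine (V.tv_all φ).trans (iInf_congr fun u => ?_)
    have : (Fin.snoc e u : Fin 1 → Name A) 0 = u := Fin.snoc_last (α := fun _ => Name A) u e
    rw [ev, Fml.close, this]; rfl
  | succ n ih =>
    have h : V.ev φ.all e = V.ev (Fml.all (φ.inst (e 0))) (Fin.tail e) := by
      rw [ev, Fml.close, Fml.inst, ev]
    refine (h.trans <| ih (Fin.tail e) (φ.inst (e 0))).trans (iInf_congr fun u => ?_)
    rw [ev, ev, Fml.close_snoc]

@[simp] lemma ev_ex (φ : Fml (Name A) (n + 1)) :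
    V.ev φ.ex e = ⨆ u, V.ev φ (Fin.snoc e u : Fin (n + 1) → Name A) := by
  induction n with
  | zero =>
    refine (V.tv_ex φ).trans (iSup_congr fun u => ?_)
    have : (Fin.snoc e u : Fin 1 → Name A) 0 = u := Fin.snoc_last (α := fun _ => Name A) u e
    rw [ev, Fml.close, this]; rfl
  | succ n ih =>
    have h : V.ev φ.ex e = V.ev (Fml.ex (φ.inst (e 0))) (Fin.tail e) := by
      rw [ev, Fml.close, Fml.inst, ev]
    refine (h.trans <| ih (Fin.tail e) (φ.inst (e 0))).trans (iSup_congr fun u => ?_)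
    rw [ev, ev, Fml.close_snoc]

@[simp] lemma ev_iff (φ ψ : Fml (Name A) n) : V.ev (φ.iff ψ) e = V.ev φ e ⇔ V.ev ψ e := by
  rw [Fml.iff, ev_and, ev_imp, ev_imp, bihimp, inf_comm]

lemma E_def (u v : Name A) : V.E u v =
    (⨅ i : u.Idx, u.val i ⇨ V.M (u.dom i) v) ⊓ ⨅ j : v.Idx, v.val j ⇨ V.M (v.dom j) u :=
  V.tv_eq u v

lemma M_def (u v : Name A) : V.M u v = ⨆ i : v.Idx, v.val i ⊓ V.E (v.dom i) u := V.tv_mem u v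

lemma E_symm (u v : Name A) : V.E u v = V.E v u := by rw [E_def, E_def, inf_comm]

/-- Reflexivity at the element is a hypothesis because `E_refl` uses this inside its own induction.
-/
lemma val_le_M (v : Name A) (i : v.Idx) (h : V.E (v.dom i) (v.dom i) = ⊤) :
    v.val i ≤ V.M (v.dom i) v := by
  rw [M_def]
  exact le_iSup_of_le i (by simp [h])

@[simp] lemma E_refl (u : Name A) : V.E u u = ⊤ := by
  induction u with
  | mk ι d a ih =>
    have (i : ι) : a i ≤ V.M (d i) (.mk ι d a) := V.val_le_M (.mk ι d a) i (ih i)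
    rw [E_def, inf_idem, iInf_eq_top]
    exact fun i => himp_eq_top_iff.2 (this i)

lemma val_inf_E_le (u v : Name A) (i : u.Idx) : u.val i ⊓ V.E u v ≤ V.M (u.dom i) v := by
  rw [inf_comm, ← le_himp_iff, E_def]
  exact inf_le_left.trans (iInf_le _ i)

lemma E_trans (u v w : Name A) : V.E u v ⊓ V.E v w ≤ V.E u w := by
  induction u generalizing v w with
  | mk ι d a ih =>
    set u : Name A := .mk ι d a
    rw [V.E_def u w]
    -- In both halves an element is carried through `v` to the far side. Up to symmetry both need
    -- transitivity only for triples starting at an element of `u`, so induction on `u` is enough.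
    refine le_inf (le_iInf fun i => ?_) (le_iInf fun k => ?_)
    · rw [le_himp_iff]
      calc V.E u v ⊓ V.E v w ⊓ u.val i ≤ V.M (u.dom i) v ⊓ V.E v w :=
            le_inf (le_trans (le_inf inf_le_right (inf_le_left.trans inf_le_left))
              (V.val_inf_E_le u v i)) (inf_le_left.trans inf_le_right)
        _ ≤ V.M (u.dom i) w := by
          rw [V.M_def _ v, iSup_inf_eq]
          refine iSup_le fun j => ?_
          have h : v.val j ⊓ V.E (v.dom j) (u.dom i) ⊓ V.E v w ≤
              V.M (v.dom j) w ⊓ V.E (v.dom j) (u.dom i) :=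
            le_inf (le_trans (inf_le_inf_right _ inf_le_left) (V.val_inf_E_le v w j))
              (inf_le_left.trans inf_le_right)
          refine h.trans ?_
          rw [V.M_def _ w, V.M_def _ w, iSup_inf_eq]
          refine iSup_mono fun k => ?_
          rw [inf_assoc]
          refine inf_le_inf_left _ ?_
          rw [inf_comm, V.E_symm _ (v.dom j), V.E_symm _ (u.dom i), V.E_symm _ (u.dom i)]
          exact ih i _ _
    · rw [le_himp_iff]
      calc V.E u v ⊓ V.E v w ⊓ w.val k ≤ V.M (w.dom k) v ⊓ V.E v u := by
            rw [V.E_symm v w, V.E_symm v u]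
            exact le_inf (le_trans (le_inf inf_le_right (inf_le_left.trans inf_le_right))
              (V.val_inf_E_le w v k)) (inf_le_left.trans inf_le_left)
        _ ≤ V.M (w.dom k) u := by
          rw [V.M_def _ v, iSup_inf_eq]
          refine iSup_le fun j => ?_
          have h : v.val j ⊓ V.E (v.dom j) (w.dom k) ⊓ V.E v u ≤
              V.M (v.dom j) u ⊓ V.E (v.dom j) (w.dom k) :=
            le_inf (le_trans (inf_le_inf_right _ inf_le_left) (V.val_inf_E_le v u j))
              (inf_le_left.trans inf_le_right)
          refine h.trans ?_
          rw [V.M_def _ u, V.M_def _ u, iSup_inf_eq]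
          refine iSup_mono fun i => ?_
          rw [inf_assoc]
          exact inf_le_inf_left _ (ih i _ _)

lemma val_le (v : Name A) (i : v.Idx) : v.val i ≤ V.M (v.dom i) v :=
  V.val_le_M v i (V.E_refl _)

/-- Substitution on the left of `∈`. -/
lemma M_left (u u' v : Name A) : V.E u u' ⊓ V.M u v ≤ V.M u' v := by
  rw [M_def, M_def, inf_iSup_eq]
  refine iSup_mono fun i => ?_
  refine le_inf (inf_le_right.trans inf_le_left) (le_trans ?_ (V.E_trans (v.dom i) u u'))
  exact le_inf (inf_le_right.trans inf_le_right) inf_le_left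

/-- Substitution on the right of `∈`. -/
lemma M_right (u v v' : Name A) : V.E v v' ⊓ V.M u v ≤ V.M u v' := by
  rw [V.M_def u v, inf_iSup_eq]
  refine iSup_le fun i => le_trans ?_ (V.M_left (v.dom i) u v')
  exact le_inf (inf_le_right.trans inf_le_right)
    (le_trans (le_inf (inf_le_right.trans inf_le_left) inf_le_left) (V.val_inf_E_le v v' i))

/-- Extensionality. -/
lemma E_eq_iInf (u v : Name A) : V.E u v = ⨅ x, V.M x u ⇔ V.M x v := by
  apply le_antisymm
  · refine le_iInf fun x => le_bihimp ?_ ?_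
    · rw [inf_comm, V.E_symm]; exact V.M_right _ _ _
    · rw [inf_comm]; exact V.M_right _ _ _
  · rw [E_def]
    refine le_inf (le_iInf fun i => (iInf_le _ (u.dom i)).trans ?_)
      (le_iInf fun i => (iInf_le _ (v.dom i)).trans ?_)
    · rw [bihimp]
      exact inf_le_right.trans (himp_le_himp_right (V.val_le u i))
    · rw [bihimp]
      exact inf_le_left.trans (himp_le_himp_right (V.val_le v i))

end TruthValue

/-! ### Prime ideals and disjointification -/

/-- If `x ≤ y` fails, a prime ideal contains `y` but not `x`, and its complement is a two-valued
homomorphism. Lattice inequalities thus become propositional ones. -/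
lemma le_of_forall_boundedLatticeHom {α : Type*} [DistribLattice α] [BoundedOrder α] {x y : α}
    (h : ∀ f : BoundedLatticeHom α Prop, f x → f y) : x ≤ y := by
  by_contra hxy
  obtain ⟨P, hP, hy, hx⟩ := DistribLattice.prime_ideal_of_disjoint_filter_ideal
    (F := Order.PFilter.principal x) (I := Order.Ideal.principal y) (by
      rw [Set.disjoint_left]
      intro z hz hz'
      exact hxy (le_trans (Order.PFilter.mem_principal.1 hz) (Order.Ideal.mem_principal.1 hz')))
  let f : BoundedLatticeHom α Prop :=
    { toFun := fun z => z ∉ P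
      map_sup' := fun a b => by
        simp only [Order.Ideal.sup_mem_iff, sup_Prop_eq, eq_iff_iff]; tauto
      map_inf' := fun a b => by
        simp only [inf_Prop_eq, eq_iff_iff]
        exact ⟨fun h => ⟨fun ha => h (P.lower inf_le_left ha), fun hb => h (P.lower inf_le_right hb)⟩,
          fun h hab => (hP.mem_or_mem hab).elim h.1 h.2⟩
      map_top' := by simpa using hP.top_notMem
      map_bot' := by simp }
  exact h f (fun hxP => Set.disjoint_left.1 hx (Order.PFilter.mem_principal.2 le_rfl) hxP)
    (hy (Order.Ideal.mem_principal.2 le_rfl))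

/-- Disjointification of a family along a well-ordering of its index type. -/
lemma iSup_le_iSup_sdiff {A : Type*} [CompleteBooleanAlgebra A] {ι : Type*} (p : ι → A) :
    ⨆ i, p i ≤ ⨆ i, p i \ ⨆ (j) (_ : WellOrderingRel j i), p j := by
  refine iSup_le fun i => ?_
  induction i using (WellOrderingRel.isWellOrder (α := ι)).wf.induction with
  | h i ih =>
    calc p i ≤ (p i \ ⨆ (j) (_ : WellOrderingRel j i), p j) ⊔
            ⨆ (j) (_ : WellOrderingRel j i), p j := by rw [sdiff_sup_self]; exact le_sup_left
      _ ≤ _ := sup_le (le_iSup (fun i => p i \ ⨆ (j) (_ : WellOrderingRel j i), p j) i)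
            (iSup₂_le ih)

lemma pairwise_disjoint_sdiff {A : Type*} [CompleteBooleanAlgebra A] {ι : Type*} (p : ι → A) :
    Pairwise (Function.onFun Disjoint
      fun i => p i \ ⨆ (j) (_ : WellOrderingRel j i), p j) := by
  have key (i j : ι) (h : WellOrderingRel i j) :
      Disjoint (p i \ ⨆ (k) (_ : WellOrderingRel k i), p k)
        (p j \ ⨆ (k) (_ : WellOrderingRel k j), p k) :=
    disjoint_sdiff_self_right.mono_left
      (sdiff_le.trans (le_iSup₂ (f := fun k (_ : WellOrderingRel k j) => p k) i h))
  intro i j hij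
  rcases trichotomous_of WellOrderingRel i j with h | h | h
  · exact key i j h
  · exact (hij h).elim
  · exact (key j i h).symm

/-! ### Names for pairs and subsets -/

namespace Name

variable {A : Type u}

/-- The unordered pair `{a, b}`. -/
def upair [Top A] (a b : Name A) : Name A :=
  mk (ULift Bool) (fun i => bif i.down then a else b) fun _ => ⊤

/-- The ordered pair `{{a}, {a, b}}`. -/
def op [Top A] (a b : Name A) : Name A := upair (upair a a) (upair a b)

/-- The subset of `X` on which `φ` holds. -/
def sep [Min A] (X : Name A) (φ : Name A → A) : Name A :=
  mk X.Idx X.dom fun i => X.val i ⊓ φ (X.dom i)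

end Name

open Name

/-! ### Mixing and the maximum principle -/

namespace TruthValue

variable {A : Type u} [CompleteBooleanAlgebra A] {S : CwStructure A} (V : TruthValue S) {n : ℕ}

/-- Predicates on names that respect `≈`. -/
def Ext (φ : Name A → A) : Prop := ∀ u v, V.E u v ⊓ φ u ≤ φ v

lemma M_sep (X : Name A) {φ : Name A → A} (hφ : V.Ext φ) (x : Name A) :
    V.M x (sep X φ) = V.M x X ⊓ φ x := by
  rw [M_def, M_def, iSup_inf_eq]
  refine iSup_congr fun i => ?_
  change X.val i ⊓ φ (X.dom i) ⊓ V.E (X.dom i) x = X.val i ⊓ V.E (X.dom i) x ⊓ φ x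
  rw [inf_assoc, inf_assoc]
  congr 1
  apply le_antisymm
  · rw [inf_comm]; exact le_inf inf_le_left (hφ _ _)
  · rw [V.E_symm]; exact le_inf (hφ _ _) inf_le_left

lemma E_congr_left (u v w : Name A) : V.E u v ⊓ V.E u w ≤ V.E v w := by
  rw [V.E_symm u v]; exact V.E_trans _ _ _

lemma ext_iSup {ι : Sort*} {φ : ι → Name A → A} (h : ∀ i, V.Ext (φ i)) :
    V.Ext fun x => ⨆ i, φ i x := fun u v => by
  rw [inf_iSup_eq]; exact iSup_mono fun i => h i u v

lemma ext_iInf {ι : Sort*} {φ : ι → Name A → A} (h : ∀ i, V.Ext (φ i)) :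
    V.Ext fun x => ⨅ i, φ i x := fun u v =>
  le_iInf fun i => (inf_le_inf_left _ (iInf_le _ i)).trans (h i u v)

lemma ext_inf {φ ψ : Name A → A} (h : V.Ext φ) (h' : V.Ext ψ) : V.Ext fun x => φ x ⊓ ψ x :=
  fun u v => le_inf ((inf_le_inf_left _ inf_le_left).trans (h u v))
    ((inf_le_inf_left _ inf_le_right).trans (h' u v))

lemma ext_himp {φ : Name A → A} (a : A) (h : V.Ext φ) : V.Ext fun x => a ⇨ φ x := fun u v => by
  rw [le_himp_iff, inf_assoc, himp_inf_self]
  exact (inf_le_inf_left _ inf_le_left).trans (h u v)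

/-- Mixing of names along an antichain. -/
lemma exists_mix {ι : Type u} {a : ι → A} (ha : Pairwise (Function.onFun Disjoint a))
    (w : ι → Name A) : ∃ u, ∀ i, a i ≤ V.E u (w i) := by
  let u : Name A := .mk (Σ i, (w i).Idx) (fun p => (w p.1).dom p.2) fun p => a p.1 ⊓ (w p.1).val p.2
  refine ⟨u, fun i => ?_⟩
  rw [E_def]
  refine le_inf (le_iInf fun p => ?_) (le_iInf fun k => ?_) <;> rw [le_himp_iff]
  · obtain ⟨j, k⟩ := p
    change a i ⊓ (a j ⊓ (w j).val k) ≤ V.M ((w j).dom k) (w i)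
    by_cases h : i = j
    · subst h
      exact (inf_le_right.trans inf_le_right).trans (V.val_le _ _)
    · rw [← inf_assoc, (ha h).eq_bot, bot_inf_eq]
      exact bot_le
  · exact V.val_le u ⟨i, k⟩

/-- The maximum principle: existential quantifiers are witnessed. -/
lemma exists_eq_iSup {φ : Name A → A} (hφ : V.Ext φ) : ∃ u, φ u = ⨆ x, φ x := by
  -- Mixing needs a small index type, and names do not form one. The values of `φ` do, being
  -- elements of `A`; one witness is chosen per value.
  choose w hw using fun p : Set.range φ => p.2
  obtain ⟨u, hu⟩ := V.exists_mix (pairwise_disjoint_sdiff fun p : Set.range φ => (p : A)) w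
  refine ⟨u, (le_iSup φ u).antisymm ?_⟩
  calc ⨆ x, φ x ≤ ⨆ p : Set.range φ, (p : A) :=
        iSup_le fun x => le_iSup (fun p : Set.range φ => (p : A)) ⟨φ x, x, rfl⟩
    _ ≤ _ := iSup_le_iSup_sdiff _
    _ ≤ φ u := iSup_le fun p => by
      refine le_trans (le_inf ?_ ?_) (hφ (w p) u)
      · rw [V.E_symm]; exact hu p
      · rw [hw p]; exact sdiff_le

/-- A name that equals `u` on `a` and `v` off `a`. -/
lemma exists_ite (a : A) (u v : Name A) : ∃ w, a ≤ V.E w u ∧ aᶜ ≤ V.E w v := by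
  obtain ⟨w, hw⟩ := V.exists_mix (a := fun i : ULift Bool => bif i.down then a else aᶜ)
    (by rintro ⟨_ | _⟩ ⟨_ | _⟩ h <;>
      first | exact (h rfl).elim | exact disjoint_compl_left | exact disjoint_compl_right)
    fun i => bif i.down then u else v
  exact ⟨w, hw ⟨true⟩, hw ⟨false⟩⟩

/-! ### Pairs and the values of the defined formulas -/

lemma iSup_M_inf_E (r t : Name A) : ⨆ w, V.M w r ⊓ V.E w t = V.M t r := by
  apply le_antisymm
  · exact iSup_le fun w => by rw [inf_comm]; exact V.M_left _ _ _
  · exact le_iSup_of_le t (by simp)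

lemma M_upair (x a b : Name A) : V.M x (upair a b) = V.E x a ⊔ V.E x b := by
  rw [M_def, V.E_symm x a, V.E_symm x b]
  apply le_antisymm
  · refine iSup_le ?_
    rintro ⟨_ | _⟩
    · exact inf_le_right.trans le_sup_right
    · exact inf_le_right.trans le_sup_left
  · exact sup_le (le_iSup_of_le ⟨true⟩ (le_inf le_top le_rfl))
      (le_iSup_of_le ⟨false⟩ (le_inf le_top le_rfl))

lemma E_upair (a b c d : Name A) : V.E (upair a b) (upair c d) =
    ((V.E a c ⊔ V.E a d) ⊓ (V.E b c ⊔ V.E b d)) ⊓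
      ((V.E c a ⊔ V.E c b) ⊓ (V.E d a ⊔ V.E d b)) := by
  have key (x y z : Name A) : (⨅ i : (upair x y).Idx, (upair x y).val i ⇨
      V.M ((upair x y).dom i) z) = V.M x z ⊓ V.M y z := by
    apply le_antisymm
    · exact le_inf (iInf_le_of_le (show (upair x y).Idx from ⟨true⟩) (top_himp (a := V.M x z)).le)
        (iInf_le_of_le (show (upair x y).Idx from ⟨false⟩) (top_himp (a := V.M y z)).le)
    · refine le_iInf ?_
      rintro ⟨_ | _⟩
      · exact inf_le_right.trans le_himp
      · exact inf_le_left.trans le_himp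
  rw [E_def, key, key, M_upair, M_upair, M_upair, M_upair]

lemma E_op (a b c d : Name A) : V.E (op a b) (op c d) = V.E a c ⊓ V.E b d := by
  have hs := V.E_symm
  have key (f : BoundedLatticeHom A Prop) :
      (∀ x, f (V.E x x)) ∧ (∀ x y z, f (V.E x y) → f (V.E y z) → f (V.E x z)) := by
    refine ⟨fun x => by simp, fun x y z h h' => ?_⟩
    have : f (V.E x y ⊓ V.E y z) := by rw [map_inf]; exact ⟨h, h'⟩
    exact OrderHomClass.mono f (V.E_trans x y z) this
  apply le_antisymm <;>
  · refine le_of_forall_boundedLatticeHom fun f => ?_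
    obtain ⟨hr, ht⟩ := key f
    simp only [op, E_upair, map_inf, map_sup, inf_Prop_eq, sup_Prop_eq]
    rw [hs c a, hs d a, hs c b, hs d b]
    -- Under a two-valued homomorphism this is the Kuratowski pair argument for an equivalence
    -- relation; these are the transitivity instances it needs.
    have h1 := ht b a c
    have h2 := ht b c a
    grind

variable (e : Fin n → Name A)

@[simp] lemma ev_allIn (t : Tm (Name A) n) (φ : Fml (Name A) (n + 1)) :
    V.ev (.allIn t φ) e =
      ⨅ u, V.M u (t.ev e) ⇨ V.ev φ (Fin.snoc e u : Fin (n + 1) → Name A) := by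
  simp [Fml.allIn]

@[simp] lemma ev_exIn (t : Tm (Name A) n) (φ : Fml (Name A) (n + 1)) :
    V.ev (.exIn t φ) e =
      ⨆ u, V.M u (t.ev e) ⊓ V.ev φ (Fin.snoc e u : Fin (n + 1) → Name A) := by
  simp [Fml.exIn]

@[simp] lemma ev_isUPair (z a b : Tm (Name A) n) :
    V.ev (.isUPair z a b) e = V.E (z.ev e) (upair (a.ev e) (b.ev e)) := by
  simp [Fml.isUPair, E_eq_iInf V (z.ev e), M_upair]

@[simp] lemma ev_isPair (p a b : Tm (Name A) n) :
    V.ev (.isPair p a b) e = V.E (p.ev e) (op (a.ev e) (b.ev e)) := by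
  simp [Fml.isPair, E_eq_iInf V (p.ev e), op, M_upair]

@[simp] lemma ev_pairMem (a b r : Tm (Name A) n) :
    V.ev (.pairMem a b r) e = V.M (op (a.ev e) (b.ev e)) (r.ev e) := by
  simp [Fml.pairMem, iSup_M_inf_E]

lemma ext_M_left (v : Name A) : V.Ext fun x => V.M x v := fun _ _ => V.M_left _ _ _

lemma ext_E (v : Name A) : V.Ext fun x => V.E v x := fun x y => by
  rw [inf_comm]; exact V.E_trans _ _ _

lemma ext_op_right (r a : Name A) : V.Ext fun x => V.M (op a x) r := fun x y => by
  have := V.M_left (op a x) (op a y) r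
  rwa [E_op, E_refl, top_inf_eq] at this

/-! ### Zorn's Lemma -/

/-- Zorn's lemma below the truth value `b` of its hypotheses. -/
lemma le_hasMaximal (X r : Name A) (b : A)
    (hrefl : ∀ a, b ⊓ V.M a X ≤ V.M (op a a) r)
    (hanti : ∀ a c, b ⊓ V.M a X ⊓ V.M c X ⊓ V.M (op a c) r ⊓ V.M (op c a) r ≤ V.E a c)
    (htrans : ∀ a c d, b ⊓ V.M a X ⊓ V.M c X ⊓ V.M d X ⊓ V.M (op a c) r ⊓ V.M (op c d) r ≤
      V.M (op a d) r)
    (hind : ∀ C, b ≤ (⨅ x, V.M x C ⇨ V.M x X) ⊓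
      (⨅ x, V.M x C ⇨ ⨅ y, V.M y C ⇨ V.M (op x y) r ⊔ V.M (op y x) r) ⇨
      ⨆ z, V.M z X ⊓ ⨅ a, V.M a C ⇨ V.M (op a z) r) :
    b ≤ ⨆ m, V.M m X ⊓ ⨅ t, V.M t X ⇨ V.M (op m t) r ⇨ V.E t m := by
  let Y := {y : Name A // b ≤ V.M y X}
  let R : Y → Y → Prop := fun y z => b ≤ V.M (op y.1 z.1) r
  have hR : ∀ c : Set Y, IsChain R c → ∃ ub, ∀ a ∈ c, R a ub := by
    intro c hc
    -- The chain `c` may be a proper class of names. Cutting it out of `X` keeps the domain small,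
    -- and its members still lie in `C` with value at least `b`.
    let φ : Name A → A := fun x => ⨆ y : c, V.E y.1.1 x
    let C := sep X φ
    have hφ : V.Ext φ := V.ext_iSup fun y => V.ext_E _
    have hC (x : Name A) : V.M x C = V.M x X ⊓ φ x := V.M_sep X hφ x
    have hchain : b ≤ (⨅ x, V.M x C ⇨ V.M x X) ⊓
        (⨅ x, V.M x C ⇨ ⨅ y, V.M y C ⇨ V.M (op x y) r ⊔ V.M (op y x) r) := by
      refine le_inf (le_iInf fun x => ?_) (le_iInf fun x => ?_)
      · rw [le_himp_iff, hC]
        exact inf_le_right.trans inf_le_left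
      · rw [le_himp_iff, le_iInf_iff]
        intro y
        rw [le_himp_iff, hC, hC]
        calc b ⊓ (V.M x X ⊓ φ x) ⊓ (V.M y X ⊓ φ y) ≤ φ x ⊓ φ y ⊓ b :=
              le_inf (inf_le_inf (inf_le_right.trans inf_le_right) inf_le_right)
                (inf_le_left.trans inf_le_left)
          _ ≤ _ := by
            rw [iSup_inf_iSup, iSup_inf_eq]
            refine iSup_le fun p => ?_
            obtain ⟨s, t⟩ := p
            have hop : V.E s.1.1 x ⊓ V.E t.1.1 y = V.E (op s.1.1 t.1.1) (op x y) := by rw [E_op]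
            have hop' : V.E s.1.1 x ⊓ V.E t.1.1 y = V.E (op t.1.1 s.1.1) (op y x) := by
              rw [E_op, inf_comm]
            have hst : R s.1 t.1 ∨ R t.1 s.1 := by
              -- `IsChain` compares distinct members only; equal ones need reflexivity.
              by_cases h : s.1 = t.1
              · left
                rw [h]
                exact (le_inf le_rfl t.1.2).trans (hrefl _)
              · exact hc s.2 t.2 h
            rcases hst with h | h
            · refine le_sup_of_le_left ((inf_le_inf_left _ h).trans ?_)
              dsimp only
              rw [hop]
              exact V.M_left _ _ _
            · refine le_sup_of_le_right ((inf_le_inf_left _ h).trans ?_)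
              dsimp only
              rw [hop']
              exact V.M_left _ _ _
    have hub := le_himp_iff.1 (hind C)
    rw [inf_eq_left.2 hchain] at hub
    -- The supremum over bounds must be attained by one name for it to be an element of `Y`.
    obtain ⟨z, hz⟩ := V.exists_eq_iSup (φ := fun z => V.M z X ⊓ ⨅ a, V.M a C ⇨ V.M (op a z) r)
      (V.ext_inf (V.ext_M_left X) (V.ext_iInf fun a => V.ext_himp _ (V.ext_op_right r a)))
    rw [← hz] at hub
    refine ⟨⟨z, hub.trans inf_le_left⟩, fun a ha => ?_⟩
    have h1 : b ≤ V.M a.1 C := by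
      rw [hC]
      exact le_inf a.2 (le_iSup_of_le ⟨a, ha⟩ (by simp))
    have h2 : b ≤ V.M a.1 C ⇨ V.M (op a.1 z) r := hub.trans (inf_le_right.trans (iInf_le _ a.1))
    exact (le_inf h2 h1).trans himp_inf_le
  obtain ⟨m, hm⟩ := exists_maximal_of_chains_bounded hR fun {x y z} hxy hyz =>
    (le_inf (le_inf (le_inf (le_inf (le_inf le_rfl x.2) y.2) z.2) hxy) hyz).trans (htrans _ _ _)
  refine le_iSup_of_le m.1 (le_inf m.2 (le_iInf fun t => ?_))
  rw [le_himp_iff, le_himp_iff]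
  -- On `d` the name `t` may contradict maximality, but it need not belong to `Y`. The mixture `w`,
  -- equal to `t` on `d` and to `m` elsewhere, does.
  set d := b ⊓ V.M t X ⊓ V.M (op m.1 t) r with hd
  obtain ⟨w, hw, hw'⟩ := V.exists_ite d t m.1
  have cases_d {x : A} (h : d ≤ x) (h' : b ⊓ dᶜ ≤ x) : b ≤ x := by
    rw [← sup_inf_sdiff b d, sdiff_eq]
    exact sup_le (inf_le_right.trans h) h'
  have hdb : d ≤ b := inf_le_left.trans inf_le_left
  have hwX : b ≤ V.M w X := by
    refine cases_d ((le_inf (V.E_symm w t ▸ hw) (inf_le_left.trans inf_le_right)).trans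
      (V.M_left t w X)) ?_
    rw [V.E_symm] at hw'
    exact (le_inf (inf_le_right.trans hw') (inf_le_left.trans m.2)).trans (V.M_left m.1 w X)
  have hmw : b ≤ V.M (op m.1 w) r := by
    refine cases_d ((le_inf (V.E_symm w t ▸ hw) inf_le_right).trans (V.ext_op_right r m.1 t w)) ?_
    rw [V.E_symm] at hw'
    exact (le_inf (inf_le_right.trans hw')
      (inf_le_left.trans ((le_inf le_rfl m.2).trans (hrefl _)))).trans (V.ext_op_right r m.1 m.1 w)
  -- Maximality of `m` gives `w ≤ m`, so antisymmetry gives `w ≈ m` on `b`; on `d` this says `t ≈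
  -- m`.
  have hwm : b ≤ V.E w m.1 :=
    (le_inf (le_inf (le_inf (le_inf le_rfl hwX) m.2) (hm ⟨w, hwX⟩ hmw)) hmw).trans (hanti _ _)
  exact (le_inf hw (hdb.trans hwm)).trans (V.E_congr_left _ _ _)

lemma iInf_himp_inf_le {ι : Sort*} (φ ψ : ι → A) (i : ι) : (⨅ j, φ j ⇨ ψ j) ⊓ φ i ≤ ψ i :=
  (inf_le_inf_right _ (iInf_le _ i)).trans himp_inf_le

lemma valid_zornLemma : V.Valid Fml.zornLemma := by
  rw [Valid, ← V.ev_sentence _ Fin.elim0, Fml.zornLemma]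
  simp only [ev_all, iInf_eq_top, ev_imp, himp_eq_top_iff]
  intro X r
  have h0 : (Fin.snoc (Fin.snoc Fin.elim0 X : Fin 1 → Name A) r : Fin 2 → Name A) 0 = X := rfl
  have h1 : (Fin.snoc (Fin.snoc Fin.elim0 X : Fin 1 → Name A) r : Fin 2 → Name A) 1 = r := rfl
  simp only [Fml.nonempty, Fml.isPartialOrder, Fml.isRefl, Fml.isAntisymm, Fml.isTrans,
    Fml.isInductive, Fml.hasMaximal, Fml.isChain, Fml.hasUpperBound, Fml.subset, ev_all, ev_ex,
    ev_and, ev_or, ev_imp, ev_allIn, ev_exIn, ev_pairMem, ev_mem, ev_eq, Tm.ev_lift, Tm.ev_new,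
    Tm.ev_var, h0, h1]
  refine V.le_hasMaximal X r _ (fun a => ?_) (fun a c => ?_) (fun a c d => ?_) (fun C => ?_)
  · rw [← le_himp_iff]
    exact (inf_le_right.trans (inf_le_left.trans inf_le_left)).trans (iInf_le _ a)
  · rw [inf_assoc (_ ⊓ _ ⊓ _)]
    refine (inf_le_inf_right _ (inf_le_inf_right _ (inf_le_inf_right _
      (inf_le_right.trans (inf_le_left.trans (inf_le_right.trans inf_le_left)))))).trans ?_
    refine (inf_le_inf_right _ (inf_le_inf_right _ (iInf_himp_inf_le _ _ a))).trans ?_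
    exact (inf_le_inf_right _ (iInf_himp_inf_le _ _ c)).trans himp_inf_le
  · rw [inf_assoc (_ ⊓ _ ⊓ _ ⊓ _)]
    refine (inf_le_inf_right _ (inf_le_inf_right _ (inf_le_inf_right _ (inf_le_inf_right _
      (inf_le_right.trans (inf_le_left.trans (inf_le_right.trans inf_le_right))))))).trans ?_
    refine (inf_le_inf_right _ (inf_le_inf_right _ (inf_le_inf_right _
      (iInf_himp_inf_le _ _ a)))).trans ?_
    refine (inf_le_inf_right _ (inf_le_inf_right _ (iInf_himp_inf_le _ _ c))).trans ?_
    exact (inf_le_inf_right _ (iInf_himp_inf_le _ _ d)).trans himp_inf_le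
  · exact (inf_le_right.trans inf_le_right).trans (iInf_le _ C)


/-! ### The axiom of choice -/

/-- Choice functions for families of non-empty sets exist with truth value `⊤`. -/
lemma exists_choice (u : Name A) : ∃ f : Name A,
    (∀ p, V.M p f ≤ ⨆ x, ⨆ y, V.E p (op x y)) ∧
    (∀ x y z, V.M (op x y) f ⊓ V.M (op x z) f ≤ V.E y z) ∧
    (∀ x, V.M x u = ⨆ y, V.M (op x y) f) ∧
    ∀ x, V.M x u ⊓ (⨆ z, V.M z x) ≤ ⨆ y, V.M (op x y) f ⊓ V.M y x := by
  choose c hc using fun i : u.Idx => V.exists_eq_iSup (V.ext_M_left (u.dom i))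
  let p : Name A → u.Idx → A := fun x i => u.val i ⊓ V.E (u.dom i) x
  -- Different indices may name equal elements with positive value, so `a i` removes the part on
  -- which an earlier index already gives `u.dom i`.
  let a : u.Idx → A := fun i => u.val i \ ⨆ (j) (_ : WellOrderingRel j i), p (u.dom i) j
  let f : Name A := .mk u.Idx (fun i => op (u.dom i) (c i)) a
  have hM (q : Name A) : V.M q f = ⨆ i, a i ⊓ V.E (op (u.dom i) (c i)) q := V.M_def _ _
  have hop (x y : Name A) : V.M (op x y) f = ⨆ i, a i ⊓ (V.E (u.dom i) x ⊓ V.E (c i) y) := by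
    simp_rw [hM, E_op]
  have hdisj (x : Name A) (i j : u.Idx) (h : WellOrderingRel i j) :
      a i ⊓ V.E (u.dom i) x ⊓ (a j ⊓ V.E (u.dom j) x) ≤ ⊥ := by
    have h1 : a j ≤ (p (u.dom j) i)ᶜ := by
      change _ \ _ ≤ _
      rw [sdiff_eq]
      exact inf_le_right.trans (compl_le_compl
        (le_iSup₂ (f := fun k (_ : WellOrderingRel k j) => p (u.dom j) k) i h))
    have h2 : a i ⊓ V.E (u.dom i) x ⊓ (a j ⊓ V.E (u.dom j) x) ≤ p (u.dom j) i := by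
      refine le_inf ((inf_le_left.trans inf_le_left).trans sdiff_le) ?_
      refine le_trans (le_inf (inf_le_left.trans inf_le_right) ?_) (V.E_trans _ x _)
      rw [V.E_symm x]
      exact inf_le_right.trans inf_le_right
    exact (le_inf h2 ((inf_le_right.trans inf_le_left).trans h1)).trans (inf_compl_self _).le
  -- Disjointify `p x`. Where `u.dom i ≈ x`, the values `p x j` and `p (u.dom i) j` agree, so the
  -- remaining part of `p x i` lies below `a i`.
  have hdom (x : Name A) : V.M x u = ⨆ i, a i ⊓ V.E (u.dom i) x := by
    rw [M_def]
    refine le_antisymm ((iSup_le_iSup_sdiff (p x)).trans (iSup_mono fun i => ?_))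
      (iSup_mono fun i => inf_le_inf_right _ sdiff_le)
    refine le_inf ?_ (sdiff_le.trans inf_le_right)
    change _ ≤ _ \ _
    rw [le_sdiff]
    refine ⟨sdiff_le.trans inf_le_left, ?_⟩
    rw [disjoint_iSup₂_iff]
    intro j hj
    rw [disjoint_iff_inf_le]
    have h1 : p x i \ (⨆ (j) (_ : WellOrderingRel j i), p x j) ≤ (p x j)ᶜ := by
      rw [sdiff_eq]
      exact inf_le_right.trans (compl_le_compl
        (le_iSup₂ (f := fun k (_ : WellOrderingRel k i) => p x k) j hj))
    refine (le_inf ?_ (inf_le_left.trans h1)).trans (inf_compl_self (p x j)).le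
    refine le_inf (inf_le_right.trans inf_le_left) ?_
    exact (le_inf (inf_le_right.trans inf_le_right)
      ((inf_le_left.trans sdiff_le).trans inf_le_right)).trans (V.E_trans _ (u.dom i) _)
  refine ⟨f, fun q => ?_, fun x y z => ?_, fun x => ?_, fun x => ?_⟩
  · rw [hM]
    refine iSup_le fun i => le_iSup₂_of_le (u.dom i) (c i) ?_
    rw [V.E_symm q]
    exact inf_le_right
  · rw [hop, hop, iSup_inf_iSup]
    refine iSup_le fun ⟨i, j⟩ => ?_
    dsimp only
    rcases trichotomous_of WellOrderingRel i j with h | h | h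
    · refine le_trans ?_ ((hdisj x i j h).trans bot_le)
      exact inf_le_inf (inf_le_inf_left _ inf_le_left) (inf_le_inf_left _ inf_le_left)
    · subst h
      exact (inf_le_inf (inf_le_right.trans inf_le_right) (inf_le_right.trans inf_le_right)).trans
        (V.E_congr_left _ _ _)
    · refine le_trans ?_ ((hdisj x j i h).trans bot_le)
      rw [inf_comm]
      exact inf_le_inf (inf_le_inf_left _ inf_le_left) (inf_le_inf_left _ inf_le_left)
  · rw [hdom]
    apply le_antisymm
    · refine iSup_le fun i => le_iSup_of_le (c i) ?_
      rw [hop]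
      exact le_iSup_of_le i (by simp)
    · refine iSup_le fun y => ?_
      rw [hop]
      exact iSup_mono fun i => inf_le_inf_left _ inf_le_left
  · rw [hdom, iSup_inf_eq]
    refine iSup_le fun i => le_iSup_of_le (c i) (le_inf ?_ ?_)
    · rw [hop]
      exact le_iSup_of_le i (by rw [E_refl, inf_top_eq]; exact inf_le_left)
    · have h : V.E (u.dom i) x ⊓ (⨆ z, V.M z x) ≤ ⨆ z, V.M z (u.dom i) := by
        rw [inf_iSup_eq, V.E_symm]
        exact iSup_mono fun z => V.M_right _ _ _
      rw [inf_assoc]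
      refine le_trans (le_inf ?_ ?_) (V.M_right (c i) (u.dom i) x)
      · exact inf_le_right.trans inf_le_left
      · rw [hc]
        exact inf_le_right.trans h

/-- The value of the axiom of choice, for a formula `ν` expressing that `x` is not empty. -/
lemma tv_choiceFor (ν : Fml (Name A) 3) : V.tv (.choiceFor ν) =
    ⨅ u, ⨆ f, ((⨅ p, V.M p f ⇨ ⨆ x, ⨆ y, V.E p (op x y)) ⊓
        ⨅ x, ⨅ y, ⨅ z, V.M (op x y) f ⊓ V.M (op x z) f ⇨ V.E y z) ⊓
      ((⨆ d, (⨅ x, V.M x d ⇔ ⨆ y, V.M (op x y) f) ⊓ V.E d u) ⊓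
        ⨅ x, V.M x u ⇨ V.ev ν ![u, f, x] ⇨ ⨆ y, V.M (op x y) f ⊓ V.M y x) := by
  rw [← V.ev_sentence _ Fin.elim0, Fml.choiceFor]
  have h0 (u f) : (Fin.snoc (Fin.snoc Fin.elim0 u : Fin 1 → Name A) f : Fin 2 → Name A) 0 = u := rfl
  have h1 (u f) : (Fin.snoc (Fin.snoc Fin.elim0 u : Fin 1 → Name A) f : Fin 2 → Name A) 1 = f := rfl
  have h3 (u f x : Name A) : (Fin.snoc (Fin.snoc (Fin.snoc Fin.elim0 u : Fin 1 → Name A) f :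
      Fin 2 → Name A) x : Fin 3 → Name A) = ![u, f, x] := by
    funext i; fin_cases i <;> rfl
  simp only [Fml.isFun, Fml.domEq, Fml.valueMem, ev_all, ev_ex, ev_and, ev_iff, ev_imp, ev_allIn,
    ev_isPair, ev_pairMem, ev_mem, ev_eq, Tm.ev_lift, Tm.ev_new, Tm.ev_var, h0, h1, h3]
  rfl

/-- Since `ν` occurs only as an antecedent, lowering its value keeps the sentence valid. This serves
both readings of "not empty". -/
lemma valid_choiceFor {ν : Fml (Name A) 3}
    (hν : ∀ u f x, V.ev ν ![u, f, x] ≤ ⨆ z, V.M z x) : V.Valid (.choiceFor ν) := by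
  rw [Valid, tv_choiceFor, iInf_eq_top]
  intro u
  obtain ⟨f, hf1, hf2, hf3, hf4⟩ := V.exists_choice u
  refine top_le_iff.1 (le_iSup_of_le f (top_le_iff.2 ?_))
  simp only [inf_eq_top_iff, iInf_eq_top, himp_eq_top_iff]
  refine ⟨⟨hf1, hf2⟩, top_le_iff.1 (le_iSup_of_le u ?_), fun x => ?_⟩
  · simp [hf3]
  · rw [le_himp_iff]
    exact (inf_le_inf_left _ (hν u f x)).trans (hf4 x)

lemma valid_axiomOfChoice : V.Valid Fml.axiomOfChoice :=
  V.valid_choiceFor fun u f x => by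
    rw [Fml.nonempty, ev_ex]
    simp only [ev_mem, Tm.ev_new, Tm.ev_lift, Tm.ev_var]
    rfl

/-! ### Negation and the empty name -/

lemma M_empty (x : Name A) : V.M x empty = ⊥ := by
  rw [M_def]
  exact iSup_of_empty (ι := PEmpty) _

lemma E_empty (x : Name A) : V.E x empty = (⨆ z, V.M z x)ᶜ := by
  simp [E_eq_iInf, M_empty, compl_iSup]

/-- By the Leibniz clause, `‖x ≈ ∅‖` and `‖¬(x ≈ ∅)‖` meet below `‖¬(∅ ≈ ∅)‖ = 0`, and `‖x ≈ ∅‖` is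
the Boolean complement of "`x` has an element". -/
lemma tv_neg_eq_empty_le (h : V.tv (.neg (eqS empty empty)) = ⊥) (x : Name A) :
    V.tv (.neg (eqS x empty)) ≤ ⨆ z, V.M z x := by
  have := V.tv_leibniz x empty (.eq (.var 0) (.const empty))
  have h' : V.E x empty ≤ V.tv (.neg (eqS x empty)) ⇨ V.tv (.neg (eqS empty empty)) := by
    simp only [Fml.inst, Tm.inst] at this
    exact this
  rw [h, himp_bot, E_empty] at h'
  exact compl_le_compl_iff_le.1 h'

lemma valid_axiomOfChoiceNeg_iff : V.Valid (Fml.axiomOfChoiceNeg empty) ↔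
    V.tv (.neg (eqS empty empty)) = ⊥ := by
  constructor
  · intro h
    rw [Valid, Fml.axiomOfChoiceNeg, tv_choiceFor, iInf_eq_top] at h
    -- In the family `{∅}`, the instance `x = ∅` of the last conjunct has an impossible conclusion,
    -- so for every `f` its value is the complement of `‖¬(∅ ≈ ∅)‖`.
    rw [← compl_eq_top, ← top_le_iff, ← h (upair empty empty)]
    refine iSup_le fun f => inf_le_right.trans (inf_le_right.trans ((iInf_le _ empty).trans ?_))
    rw [M_upair, E_refl, sup_idem, top_himp, ev_neg_eq]
    simp [M_empty]
  · intro h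
    refine V.valid_choiceFor fun u f x => ?_
    rw [ev_neg_eq]
    exact V.tv_neg_eq_empty_le h x

end TruthValue

end CwSet

theorem mainTheorem9 {A : Type*} [CompleteBooleanAlgebra A] (S : CwSet.CwStructure A)
    (V : CwSet.TruthValue S) :
    V.Valid CwSet.Fml.zornLemma ∧
    V.Valid CwSet.Fml.axiomOfChoice ∧
    (V.Valid (CwSet.Fml.axiomOfChoiceNeg CwSet.Name.empty) ↔
      V.tv (.neg (CwSet.eqS CwSet.Name.empty CwSet.Name.empty)) = ⊥) :=
  ⟨V.valid_zornLemma, V.valid_axiomOfChoice, V.valid_axiomOfChoiceNeg_iff⟩
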